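/- Let $N\ge 2$ be an integer, $f:\mathbb R\to\mathbb R$ locally Lipschitz, $I=(0,1)$, and $T>0$, $K\ge 0$, $C_0>0$, $\beta>0$. **Continuous problem.** Let $u^0\in C([0,1])$ and let $u:[0,1]\times[0,T]\to\mathbb R$ satisfy $$u_t=u_{xx}+\tfrac{N-1}{x}u_x+f(u)\ \ (0<x<1,\ 0<t\le T),\qquad u_x(0,t)=u(1,t)=0\ \ (0<t\le T),\qquad u(x,0)=u^0(x)\ \ (x\in I).$$ Assume that $u$ is smooth in the sense that all the derivatives in $$\kappa(u)=\sum_{k=0}^{2}\|\partial_x^k u\|_{L^\infty(Q_T)}+\sum_{l=1}^{2}\|\partial_t^l u\|_{L^\infty(Q_T)}+\sum_{k=1}^{2}\|\partial_t\partial_x^k u\|_{L^\infty(Q_T)}$$ exist and are continuous on $Q_T=[0,1]\times[0,T]$, and that $\kappa(u)\le K$. **Discretization.** Let $0=x_0<x_1<\dots<x_m=1$ ($m\ge1$), $h_j=x_j-x_{j-1}$, $h=\max_j h_j$, and assume $h\le\beta\min_j h_j$. Let $S_h$ be the space of continuous functions on $[0,1]$ that are affine on each $[x_{j-1},x_j]$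 and vanish at $x=1$, with nodal basis $\phi_0,\dots,\phi_{m-1}$, $\phi_i(x_j)=\delta_{ij}$. Put $$(w,v)=\int_0^1x^{N-1}wv\,dx,\qquad A(w,v)=\int_0^1x^{N-1}w_xv_x\,dx,\qquad \langle w,v\rangle=\sum_{i=0}^{m-1}w(x_i)v(x_i)(1,\phi_i).$$ Let $\tau_0,\tau_1,\dots>0$ be time increments with $\tau=\sup_{j\ge0}\tau_j<\infty$, and $t_n=\sum_{j<n}\tau_j$. Assume the time-step restriction $$\tau\le\min_{0\le i\le m-1}\frac{(1,\phi_i)}{A(\phi_i,\phi_i)}.$$ Let $u_h^n\in S_h$ ($n\ge0$) be the solution of the explicit mass-lumped scheme (ML–2) $$\Big\langle\frac{u_h^{n+1}-u_h^n}{\tau_n},\chi\Big\rangle+A(u_h^n,\chi)=\langle f(u_h^n),\chi\rangle\qquad(\chi\in S_h,\ n\ge0),$$ with an initial value $u_h^0\in S_h$ such that $\|u_h^0-u^0\|_{L^\infty(I)}\le C_0h^2$. **Theorem 2.6.** There are constants $C,h_*,\tau_*>0$, depending only on $T,f,K,C_0,N,\beta$ (in particular not on $u$, the mesh or the time increments),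 such that, whenever all of the above holds with $h\le h_*$ and $\tau\le\tau_*$, $$\sup_{0\le t_n\le T}\|u_h^n-u(\cdot,t_n)\|_{L^\infty(I)}\le C(h+\tau).$$ -/

import Mathlib

open scoped ENNReal NNReal

noncomputable section

namespace RadialFEM

/-! ### Norms, derivatives and the continuous problem -/

/-- The sup norm of `v` on the set `s`, with values in `[0, ∞]`. -/
def supNorm {α : Type*} (s : Set α) (v : α → ℝ) : ℝ≥0∞ := ⨆ y ∈ s, ‖v y‖ₑ

/-- The closed space-time cylinder `[0,1] × [0,T]`. -/
def cylinder (T : ℝ) : Set (ℝ × ℝ) := Set.Icc (0 : ℝ) 1 ×ˢ Set.Icc (0 : ℝ) T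

/-- The partial derivative `∂ₓᵏ u (x,t)` on `[0,1]` (one-sided at the end points). -/
def partialX (k : ℕ) (u : ℝ → ℝ → ℝ) (x t : ℝ) : ℝ :=
  iteratedDerivWithin k (fun y => u y t) (Set.Icc (0 : ℝ) 1) x

/-- The partial derivative `∂ₜˡ u (x,t)` on `[0,T]` (one-sided at the end points). -/
def partialT (T : ℝ) (l : ℕ) (u : ℝ → ℝ → ℝ) (x t : ℝ) : ℝ :=
  iteratedDerivWithin l (fun s => u x s) (Set.Icc (0 : ℝ) T) t

/-- The mixed partial derivative `∂ₜ ∂ₓᵏ u (x,t)` on the cylinder. -/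
def partialTX (T : ℝ) (k : ℕ) (u : ℝ → ℝ → ℝ) (x t : ℝ) : ℝ :=
  derivWithin (fun s => partialX k u x s) (Set.Icc (0 : ℝ) T) t

/-- All the derivatives that enter `kappa` exist and are continuous on `[0,1] × [0,T]`. -/
structure IsSmooth (T : ℝ) (u : ℝ → ℝ → ℝ) : Prop where
  contDiff_x : ∀ t ∈ Set.Icc (0 : ℝ) T, ContDiffOn ℝ 2 (fun x => u x t) (Set.Icc 0 1)
  contDiff_t : ∀ x ∈ Set.Icc (0 : ℝ) 1, ContDiffOn ℝ 2 (fun t => u x t) (Set.Icc 0 T)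
  diff_tx : ∀ k ∈ Finset.Icc 1 2, ∀ x ∈ Set.Icc (0 : ℝ) 1,
    DifferentiableOn ℝ (fun t => partialX k u x t) (Set.Icc 0 T)
  cont_x : ∀ k ∈ Finset.Icc 0 2,
    ContinuousOn (fun p : ℝ × ℝ => partialX k u p.1 p.2) (cylinder T)
  cont_t : ∀ l ∈ Finset.Icc 1 2,
    ContinuousOn (fun p : ℝ × ℝ => partialT T l u p.1 p.2) (cylinder T)
  cont_tx : ∀ k ∈ Finset.Icc 1 2,
    ContinuousOn (fun p : ℝ × ℝ => partialTX T k u p.1 p.2) (cylinder T)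

/-- The quantity `κ(u)`: the sum of the sup norms on `[0,1] × [0,T]` of `∂ₓᵏ u` (`0 ≤ k ≤ 2`),
`∂ₜˡ u` (`1 ≤ l ≤ 2`) and `∂ₜ ∂ₓᵏ u` (`1 ≤ k ≤ 2`). -/
def kappa (T : ℝ) (u : ℝ → ℝ → ℝ) : ℝ≥0∞ :=
  (∑ k ∈ Finset.Icc 0 2, supNorm (cylinder T) (fun p => partialX k u p.1 p.2)) +
  (∑ l ∈ Finset.Icc 1 2, supNorm (cylinder T) (fun p => partialT T l u p.1 p.2)) +
  (∑ k ∈ Finset.Icc 1 2, supNorm (cylinder T) (fun p => partialTX T k u p.1 p.2))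

/-- `u` solves, up to time `T`, the radial semilinear heat equation
`u_t = u_xx + (N-1)/x u_x + f(u)` for `0 < x < 1`, with `u_x(0,t) = u(1,t) = 0` and
`u(x,0) = u⁰(x)`. -/
structure IsSolution (N : ℕ) (f : ℝ → ℝ) (T : ℝ) (u₀ : ℝ → ℝ) (u : ℝ → ℝ → ℝ) : Prop where
  equation : ∀ x ∈ Set.Ioo (0 : ℝ) 1, ∀ t ∈ Set.Ioc (0 : ℝ) T,
    partialT T 1 u x t = partialX 2 u x t + ((N : ℝ) - 1) / x * partialX 1 u x t + f (u x t)
  boundary_zero : ∀ t ∈ Set.Ioc (0 : ℝ) T, partialX 1 u 0 t = 0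
  boundary_one : ∀ t ∈ Set.Ioc (0 : ℝ) T, u 1 t = 0
  initial : ∀ x ∈ Set.Ioo (0 : ℝ) 1, u x 0 = u₀ x

/-! ### Bilinear forms -/

/-- The weighted inner product `(w,v) = ∫₀¹ x^{N-1} w v dx`. -/
def wInner (N : ℕ) (w v : ℝ → ℝ) : ℝ := ∫ x in (0 : ℝ)..1, x ^ (N - 1) * (w x * v x)

/-- The form `A(w,v) = ∫₀¹ x^{N-1} w_x v_x dx`. It is applied to piecewise affine functions only,
for which `deriv` is the weak derivative away from the finitely many nodes. -/
def aForm (N : ℕ) (w v : ℝ → ℝ) : ℝ :=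
  ∫ x in (0 : ℝ)..1, x ^ (N - 1) * (deriv w x * deriv v x)

/-! ### Meshes and the finite element space -/

/-- Node points `0 = x₀ < x₁ < ⋯ < x_m = 1` with `m ≥ 1` (the values `x j` for `j > m`
play no role). -/
structure Mesh where
  m : ℕ
  m_pos : 0 < m
  x : ℕ → ℝ
  x_zero : x 0 = 0
  x_last : x m = 1
  x_lt : ∀ j < m, x j < x (j + 1)

namespace Mesh

/-- The granularity `h = max_j (x_{j+1} - x_j)`. -/
def h (M : Mesh) : ℝ := ⨆ j : Fin M.m, (M.x (j + 1) - M.x j)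

/-- Quasi-uniformity: `h ≤ β min_j (x_{j+1} - x_j)`. -/
def QuasiUniform (M : Mesh) (β : ℝ) : Prop := ∀ j < M.m, M.h ≤ β * (M.x (j + 1) - M.x j)

/-- The P1 finite element space: continuous functions on `[0,1]` that are affine on every
element and vanish at `1`. (Values outside `[0,1]` play no role.) -/
def space (M : Mesh) : Set (ℝ → ℝ) :=
  {v | ContinuousOn v (Set.Icc 0 1) ∧
    (∀ j < M.m, ∃ a b : ℝ, ∀ y ∈ Set.Ioo (M.x j) (M.x (j + 1)), v y = a + b * y) ∧
    v 1 = 0}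

/-- The nodal basis function `φ_i`, `0 ≤ i < m`. -/
def hat (M : Mesh) (i : ℕ) (y : ℝ) : ℝ :=
  if M.x i ≤ y then max 0 ((M.x (i + 1) - y) / (M.x (i + 1) - M.x i))
  else max 0 ((y - M.x (i - 1)) / (M.x i - M.x (i - 1)))

/-- The mass-lumped product `⟨w,v⟩ = ∑_{i=0}^{m-1} w(x_i) v(x_i) (1,φ_i)`. -/
def lumped (M : Mesh) (N : ℕ) (w v : ℝ → ℝ) : ℝ :=
  ∑ i ∈ Finset.range M.m, w (M.x i) * v (M.x i) * wInner N (fun _ => 1) (M.hat i)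

end Mesh

/-! ### Time grids and the scheme -/

/-- Positive time increments `τ_0, τ_1, …` with finite supremum. -/
structure TimeGrid where
  step : ℕ → ℝ
  step_pos : ∀ n, 0 < step n
  bdd : BddAbove (Set.range step)

namespace TimeGrid

/-- `t_n = ∑_{j<n} τ_j`. -/
def time (G : TimeGrid) (n : ℕ) : ℝ := ∑ j ∈ Finset.range n, G.step j

/-- `τ = sup_j τ_j`. -/
def tau (G : TimeGrid) : ℝ := ⨆ j, G.step j

end TimeGrid

/-- The time-step restriction `τ ≤ min_{0 ≤ i ≤ m-1} (1,φ_i) / A(φ_i,φ_i)`. -/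
def StepRestriction (N : ℕ) (M : Mesh) (G : TimeGrid) : Prop :=
  ∀ i < M.m, G.tau ≤ wInner N (fun _ => 1) (M.hat i) / aForm N (M.hat i) (M.hat i)

/-- `uh 0, uh 1, …` in the finite element space is a solution of the explicit mass-lumped scheme
`⟨(u_h^{n+1} - u_h^n)/τ_n, χ⟩ + A(u_h^n, χ) = ⟨f(u_h^n), χ⟩` for all `χ` in the space. -/
structure IsML2Solution (N : ℕ) (f : ℝ → ℝ) (M : Mesh) (G : TimeGrid)
    (uh : ℕ → ℝ → ℝ) : Prop where
  mem : ∀ n, uh n ∈ M.space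
  scheme : ∀ n, ∀ χ ∈ M.space,
    M.lumped N (fun y => (uh (n + 1) y - uh n y) / G.step n) χ + aForm N (uh n) χ =
      M.lumped N (fun y => f (uh n y)) χ

end RadialFEM

end

/-!
In one space dimension the Ritz projection of `u(·, t)` is explicit: its slope on an element is the
mean of `u_x` with weight `x^{N-1}`. Hence it is `O(h)` close to `u(·, t)` at the nodes, its time
increments approximate those of `u` equally well, and integrating `(x^{N-1} u_x)_x` by parts against
a hat function shows that it satisfies the nodal equations of the scheme up to a truncation error
`O(h + τ)`. Under the time-step restriction one explicit step replaces each nodal value by a convex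
combination of itself and its neighbours, so errors are not amplified except through `f`, and the
discrete Gronwall lemma keeps them of size `O(h + τ)`. This bound also keeps the discrete solution
in `[-(K + 1), K + 1]`, on which `f` is Lipschitz.
-/


namespace RadialFEM

open Set

/-! ### Calculus on an interval -/

lemma supNorm_le_ofReal {α : Type*} {s : Set α} {v : α → ℝ} {c : ℝ} (hc : 0 ≤ c) :
    supNorm s v ≤ ENNReal.ofReal c ↔ ∀ y ∈ s, |v y| ≤ c := by
  simp only [supNorm, iSup₂_le_iff, ← ofReal_norm, Real.norm_eq_abs,
    ENNReal.ofReal_le_ofReal_iff hc]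

lemma norm_deriv_le_of_norm_sub_le {E : Type*} [NormedAddCommGroup E] [NormedSpace ℝ E]
    {s : Set ℝ} {g : ℝ → E} {g' : E} {t C : ℝ} (hs : UniqueDiffWithinAt ℝ s t)
    (hg : HasDerivWithinAt g g' s t) (hC : ∀ r ∈ s, ‖g r - g t‖ ≤ C * |r - t|) : ‖g'‖ ≤ C := by
  have : (nhdsWithin t (s \ {t})).NeBot := accPt_principal_iff_nhdsWithin.1 hs.accPt
  refine le_of_tendsto (hasDerivWithinAt_iff_tendsto_slope.1 hg).norm ?_
  filter_upwards [self_mem_nhdsWithin] with r hr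
  have hrt : 0 < |r - t| := abs_pos.2 (sub_ne_zero.2 hr.2)
  rw [slope_def_module, norm_smul, norm_inv, Real.norm_eq_abs, inv_mul_le_iff₀ hrt, mul_comm]
  exact hC r hr.1

lemma hasDerivWithinAt_iteratedDerivWithin {n k : ℕ} (hk : k < n) {g : ℝ → ℝ} {s : Set ℝ}
    (hs : UniqueDiffOn ℝ s) (hg : ContDiffOn ℝ n g s) {x : ℝ} (hx : x ∈ s) :
    HasDerivWithinAt (iteratedDerivWithin k g s) (iteratedDerivWithin (k + 1) g s x) s x := by
  rw [iteratedDerivWithin_succ]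
  exact (hg.differentiableOn_iteratedDerivWithin (mod_cast hk) hs x hx).hasDerivWithinAt

lemma exists_sub_eq_mul_deriv {a b : ℝ} (hab : a ≤ b) {g g' : ℝ → ℝ}
    (hg : ∀ x ∈ Icc a b, HasDerivWithinAt g (g' x) (Icc a b) x) :
    ∃ ξ ∈ Icc a b, g b - g a = (b - a) * g' ξ := by
  rcases hab.eq_or_lt with rfl | hlt
  · exact ⟨a, ⟨le_rfl, le_rfl⟩, by simp⟩
  obtain ⟨ξ, hξ, hslope⟩ := exists_hasDerivAt_eq_slope g g' hlt
    (fun x hx => (hg x hx).continuousWithinAt)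
    (fun x hx => (hg x (Ioo_subset_Icc_self hx)).hasDerivAt (Icc_mem_nhds hx.1 hx.2))
  exact ⟨ξ, Ioo_subset_Icc_self hξ, by rw [hslope, mul_div_cancel₀ _ (sub_pos.2 hlt).ne']⟩

lemma abs_taylor_one_le {a b : ℝ} (hab : a ≤ b) {K : ℝ≥0} {g g' : ℝ → ℝ}
    (hg : ∀ x ∈ Icc a b, HasDerivWithinAt g (g' x) (Icc a b) x)
    (hK : LipschitzOnWith K g' (Icc a b)) :
    |g b - g a - (b - a) * g' a| ≤ K * (b - a) ^ 2 := by
  obtain ⟨ξ, hξ, hmean⟩ := exists_sub_eq_mul_deriv hab hg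
  have hg' : |g' ξ - g' a| ≤ K * |ξ - a| := hK.dist_le_mul ξ hξ a ⟨le_rfl, hab⟩
  rw [abs_of_nonneg (sub_nonneg.2 hξ.1)] at hg'
  rw [hmean, ← mul_sub, abs_mul, abs_of_nonneg (sub_nonneg.2 hab)]
  calc (b - a) * |g' ξ - g' a| ≤ (b - a) * (K * (b - a)) := by
        gcongr
        exact hg'.trans (by gcongr; exact hξ.2)
    _ = K * (b - a) ^ 2 := by ring

lemma abs_integral_mul_sub_le {a b c δ : ℝ} (hab : a ≤ b) {p g : ℝ → ℝ}
    (hp : ContinuousOn p (Icc a b)) (hp0 : ∀ y ∈ Icc a b, 0 ≤ p y)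
    (hg : ContinuousOn g (Icc a b)) (hδ : ∀ y ∈ Icc a b, p y ≠ 0 → |g y - c| ≤ δ) :
    |(∫ y in a..b, p y * g y) - c * ∫ y in a..b, p y| ≤ δ * ∫ y in a..b, p y := by
  have hpi : IntervalIntegrable p MeasureTheory.volume a b := hp.intervalIntegrable_of_Icc hab
  have hpgi : IntervalIntegrable (fun y => p y * g y) MeasureTheory.volume a b :=
    (hp.mul hg).intervalIntegrable_of_Icc hab
  rw [← intervalIntegral.integral_const_mul, ← intervalIntegral.integral_const_mul,
    ← intervalIntegral.integral_sub hpgi (hpi.const_mul c), ← Real.norm_eq_abs]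
  refine intervalIntegral.norm_integral_le_of_norm_le hab
    (Filter.Eventually.of_forall fun y hy => ?_) (hpi.const_mul δ)
  have hy' := Ioc_subset_Icc_self hy
  rw [Real.norm_eq_abs, show p y * g y - c * p y = (g y - c) * p y by ring, abs_mul,
    abs_of_nonneg (hp0 y hy')]
  rcases eq_or_ne (p y) 0 with h | h
  · simp only [h, mul_zero, le_refl]
  · exact mul_le_mul_of_nonneg_right (hδ y hy' h) (hp0 y hy')

/-! ### Regularity of the exact solution -/

section Smooth

variable {T : ℝ} {u : ℝ → ℝ → ℝ} {K : ℝ≥0} {x y s t : ℝ}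

lemma abs_partialX_le (hκ : kappa T u ≤ K) {k : ℕ} (hk : k ∈ Finset.Icc 0 2)
    (hx : x ∈ Icc 0 1) (ht : t ∈ Icc 0 T) : |partialX k u x t| ≤ K := by
  refine (supNorm_le_ofReal (s := cylinder T) (v := fun p => partialX k u p.1 p.2)
    K.coe_nonneg).1 ?_ (x, t) ⟨hx, ht⟩
  rw [ENNReal.ofReal_coe_nnreal]
  exact (Finset.single_le_sum_of_canonicallyOrdered (f := fun k => supNorm (cylinder T) fun p =>
    partialX k u p.1 p.2) hk).trans ((le_self_add.trans le_self_add).trans hκ)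

lemma abs_partialT_le (hκ : kappa T u ≤ K) {l : ℕ} (hl : l ∈ Finset.Icc 1 2)
    (hx : x ∈ Icc 0 1) (ht : t ∈ Icc 0 T) : |partialT T l u x t| ≤ K := by
  refine (supNorm_le_ofReal (s := cylinder T) (v := fun p => partialT T l u p.1 p.2)
    K.coe_nonneg).1 ?_ (x, t) ⟨hx, ht⟩
  rw [ENNReal.ofReal_coe_nnreal]
  exact (Finset.single_le_sum_of_canonicallyOrdered (f := fun l => supNorm (cylinder T) fun p =>
    partialT T l u p.1 p.2) hl).trans ((le_add_self.trans le_self_add).trans hκ)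

lemma abs_partialTX_le (hκ : kappa T u ≤ K) {k : ℕ} (hk : k ∈ Finset.Icc 1 2)
    (hx : x ∈ Icc 0 1) (ht : t ∈ Icc 0 T) : |partialTX T k u x t| ≤ K := by
  refine (supNorm_le_ofReal (s := cylinder T) (v := fun p => partialTX T k u p.1 p.2)
    K.coe_nonneg).1 ?_ (x, t) ⟨hx, ht⟩
  rw [ENNReal.ofReal_coe_nnreal]
  exact (Finset.single_le_sum_of_canonicallyOrdered (f := fun k => supNorm (cylinder T) fun p =>
    partialTX T k u p.1 p.2) hk).trans (le_add_self.trans hκ)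

lemma partialX_zero : partialX 0 u = u := by
  ext; simp only [partialX, iteratedDerivWithin_zero]

lemma partialT_zero : partialT T 0 u = u := by
  ext; simp only [partialT, iteratedDerivWithin_zero]

namespace IsSmooth

variable (hs : IsSmooth T u)
include hs

lemma hasDerivWithinAt_partialX {k : ℕ} (hk : k < 2) (hx : x ∈ Icc 0 1) (ht : t ∈ Icc 0 T) :
    HasDerivWithinAt (fun y => partialX k u y t) (partialX (k + 1) u x t) (Icc 0 1) x :=
  hasDerivWithinAt_iteratedDerivWithin hk (uniqueDiffOn_Icc one_pos) (hs.contDiff_x t ht) hx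

lemma hasDerivWithinAt_partialT (hT : 0 < T) {l : ℕ} (hl : l < 2) (hx : x ∈ Icc 0 1)
    (ht : t ∈ Icc 0 T) :
    HasDerivWithinAt (fun s => partialT T l u x s) (partialT T (l + 1) u x t) (Icc 0 T) t :=
  hasDerivWithinAt_iteratedDerivWithin hl (uniqueDiffOn_Icc hT) (hs.contDiff_t x hx) ht

lemma hasDerivWithinAt_space (hx : x ∈ Icc 0 1) (ht : t ∈ Icc 0 T) :
    HasDerivWithinAt (fun y => u y t) (partialX 1 u x t) (Icc 0 1) x := by
  simpa only [partialX_zero] using hs.hasDerivWithinAt_partialX two_pos hx ht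

lemma hasDerivWithinAt_time (hT : 0 < T) (hx : x ∈ Icc 0 1) (ht : t ∈ Icc 0 T) :
    HasDerivWithinAt (fun s => u x s) (partialT T 1 u x t) (Icc 0 T) t := by
  simpa only [partialT_zero] using hs.hasDerivWithinAt_partialT hT two_pos hx ht

lemma continuousOn_time (hx : x ∈ Icc 0 1) : ContinuousOn (fun t => u x t) (Icc 0 T) :=
  (hs.contDiff_t x hx).continuousOn

lemma continuousOn_partialX_time {k : ℕ} (hk : k ∈ Finset.Icc 1 2) (hx : x ∈ Icc 0 1) :
    ContinuousOn (fun t => partialX k u x t) (Icc 0 T) :=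
  (hs.diff_tx k hk x hx).continuousOn

variable (hκ : kappa T u ≤ K)
include hκ

lemma lipschitzOnWith_partialX {k : ℕ} (hk : k < 2) (ht : t ∈ Icc 0 T) :
    LipschitzOnWith K (fun x => partialX k u x t) (Icc 0 1) :=
  (convex_Icc 0 1).lipschitzOnWith_of_nnnorm_hasDerivWithin_le
    (fun _ hx => hs.hasDerivWithinAt_partialX hk hx ht)
    (fun _ hx => abs_partialX_le hκ (Finset.mem_Icc.2 ⟨zero_le, hk⟩) hx ht)

lemma lipschitzOnWith_space (ht : t ∈ Icc 0 T) :
    LipschitzOnWith K (fun x => u x t) (Icc 0 1) := by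
  simpa only [partialX_zero] using hs.lipschitzOnWith_partialX hκ two_pos ht

lemma abs_partialX_sub_le {k : ℕ} (hk : k ∈ Finset.Icc 1 2) (hx : x ∈ Icc 0 1)
    (ht : t ∈ Icc 0 T) (hs' : s ∈ Icc 0 T) :
    |partialX k u x t - partialX k u x s| ≤ K * |t - s| :=
  (convex_Icc 0 T).norm_image_sub_le_of_norm_hasDerivWithin_le
    (fun r hr => (hs.diff_tx k hk x hx r hr).hasDerivWithinAt)
    (fun _ hr => abs_partialTX_le hκ hk hx hr) hs' ht

lemma lipschitzOnWith_partialX_sub {k : ℕ} (hk : k < 2) (ht : t ∈ Icc 0 T)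
    (hs' : s ∈ Icc 0 T) :
    LipschitzOnWith (K * nndist t s) (fun x => partialX k u x t - partialX k u x s)
      (Icc 0 1) :=
  (convex_Icc 0 1).lipschitzOnWith_of_nnnorm_hasDerivWithin_le
    (fun _ hx => (hs.hasDerivWithinAt_partialX hk hx ht).sub
      (hs.hasDerivWithinAt_partialX hk hx hs'))
    (fun _ hx => hs.abs_partialX_sub_le hκ
      (Finset.mem_Icc.2 ⟨Nat.le_add_left 1 k, hk⟩) hx ht hs')

variable (hT : 0 < T)
include hT

lemma lipschitzOnWith_partialT (ht : t ∈ Icc 0 T) :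
    LipschitzOnWith K (fun x => partialT T 1 u x t) (Icc 0 1) := by
  refine LipschitzOnWith.of_dist_le_mul fun x hx y hy => ?_
  have hderiv : HasDerivWithinAt (fun r => u x r - u y r)
      (partialT T 1 u x t - partialT T 1 u y t) (Icc 0 T) t :=
    (hs.hasDerivWithinAt_time hT hx ht).sub (hs.hasDerivWithinAt_time hT hy ht)
  refine norm_deriv_le_of_norm_sub_le (uniqueDiffOn_Icc hT t ht) hderiv fun r hr => ?_
  have hsub := (hs.lipschitzOnWith_partialX_sub hκ two_pos hr ht).dist_le_mul x hx y hy
  rw [partialX_zero, Real.dist_eq, NNReal.coe_mul, coe_nndist, Real.dist_eq r t] at hsub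
  rw [Real.norm_eq_abs, sub_sub_sub_comm, mul_right_comm]
  exact hsub

lemma abs_taylor_time_le (hx : x ∈ Icc 0 1) (hs' : 0 ≤ s) (hst : s ≤ t) (ht : t ≤ T) :
    |u x t - u x s - (t - s) * partialT T 1 u x s| ≤ K * (t - s) ^ 2 := by
  have hsub : Icc s t ⊆ Icc 0 T := Icc_subset_Icc hs' ht
  have hderiv : ∀ r ∈ Icc s t,
      HasDerivWithinAt (fun r => u x r) (partialT T 1 u x r) (Icc s t) r := fun r hr =>
    (hs.hasDerivWithinAt_time hT hx (hsub hr)).mono hsub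
  have hlip : LipschitzOnWith K (fun r => partialT T 1 u x r) (Icc 0 T) :=
    (convex_Icc 0 T).lipschitzOnWith_of_nnnorm_hasDerivWithin_le
      (fun _ hr => hs.hasDerivWithinAt_partialT hT one_lt_two hx hr)
      (fun _ hr => abs_partialT_le hκ (by decide) hx hr)
  exact abs_taylor_one_le hst hderiv (hlip.mono hsub)

end IsSmooth

end Smooth

section Solution

variable {N : ℕ} {f : ℝ → ℝ} {T : ℝ} {u₀ : ℝ → ℝ} {u : ℝ → ℝ → ℝ} {x t : ℝ}

lemma eqOn_Icc_of_eqOn_Ioc {T : ℝ} (hT : 0 < T) {p q : ℝ → ℝ} (hp : ContinuousOn p (Icc 0 T))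
    (hq : ContinuousOn q (Icc 0 T)) (h : EqOn p q (Ioc 0 T)) : EqOn p q (Icc 0 T) :=
  h.of_subset_closure hp hq Ioc_subset_Icc_self (closure_Ioc hT.ne).ge

namespace IsSolution

variable (hu : IsSolution N f T u₀ u) (hs : IsSmooth T u) (hT : 0 < T)
include hu hs hT

lemma boundary_zero_Icc (ht : t ∈ Icc 0 T) : partialX 1 u 0 t = 0 :=
  eqOn_Icc_of_eqOn_Ioc hT (hs.continuousOn_partialX_time (by decide) ⟨le_rfl, zero_le_one⟩)
    continuousOn_const hu.boundary_zero ht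

lemma boundary_one_Icc (ht : t ∈ Icc 0 T) : u 1 t = 0 :=
  eqOn_Icc_of_eqOn_Ioc hT (hs.continuousOn_time ⟨zero_le_one, le_rfl⟩) continuousOn_const
    hu.boundary_one ht

lemma initial_Icc (hu₀ : ContinuousOn u₀ (Icc 0 1)) : EqOn (fun x => u x 0) u₀ (Icc 0 1) :=
  EqOn.of_subset_closure hu.initial (hs.contDiff_x 0 ⟨le_rfl, hT.le⟩).continuousOn hu₀
    Ioo_subset_Icc_self (closure_Ioo zero_ne_one).ge

lemma equation_Icc (hf : Continuous f) (hx : x ∈ Ioo 0 1) (ht : t ∈ Icc 0 T) :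
    partialT T 1 u x t =
      partialX 2 u x t + ((N : ℝ) - 1) / x * partialX 1 u x t + f (u x t) := by
  have hx' := Ioo_subset_Icc_self hx
  refine eqOn_Icc_of_eqOn_Ioc hT
    (fun t ht => (hs.hasDerivWithinAt_partialT hT one_lt_two hx' ht).continuousWithinAt) ?_
    (fun t ht => hu.equation x hx t ht) ht
  exact ((hs.continuousOn_partialX_time (by decide) hx').add
    (continuousOn_const.mul (hs.continuousOn_partialX_time (by decide) hx'))).add
    (hf.comp_continuousOn (hs.continuousOn_time hx'))

lemma hasDerivAt_partialX_one (hf : Continuous f) (hx : x ∈ Ioo 0 1) (ht : t ∈ Icc 0 T) :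
    HasDerivAt (fun y => partialX 1 u y t)
      (partialT T 1 u x t - f (u x t) - ((N : ℝ) - 1) / x * partialX 1 u x t) x := by
  rw [hu.equation_Icc hs hT hf hx ht, add_sub_cancel_right, add_sub_cancel_right]
  exact (hs.hasDerivWithinAt_partialX one_lt_two (Ioo_subset_Icc_self hx) ht).hasDerivAt
    (Icc_mem_nhds hx.1 hx.2)

end IsSolution

end Solution

/-! ### Meshes and hat functions -/

namespace Mesh

section

variable (M : Mesh)

lemma strictMonoOn_x : StrictMonoOn M.x (Iic M.m) :=
  strictMonoOn_of_lt_add_one ordConnected_Iic fun j _ _ hj => M.x_lt j hj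

lemma x_mono {i j : ℕ} (hij : i ≤ j) (hj : j ≤ M.m) : M.x i ≤ M.x j :=
  M.strictMonoOn_x.monotoneOn (hij.trans hj) hj hij

lemma x_lt_x {i j : ℕ} (hij : i < j) (hj : j ≤ M.m) : M.x i < M.x j :=
  M.strictMonoOn_x (hij.le.trans hj) hj hij

lemma x_mem {i : ℕ} (hi : i ≤ M.m) : M.x i ∈ Icc (0 : ℝ) 1 :=
  ⟨M.x_zero.ge.trans (M.x_mono i.zero_le hi), (M.x_mono hi le_rfl).trans M.x_last.le⟩

lemma x_pred_le {i : ℕ} (hi : i ≤ M.m) : M.x (i - 1) ≤ M.x i := M.x_mono (i.sub_le 1) hi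

lemma Icc_subset {i j : ℕ} (hi : i ≤ M.m) (hj : j ≤ M.m) :
    Icc (M.x i) (M.x j) ⊆ Icc (0 : ℝ) 1 :=
  Icc_subset_Icc (M.x_mem hi).1 (M.x_mem hj).2

lemma sub_le_h {j : ℕ} (hj : j < M.m) : M.x (j + 1) - M.x j ≤ M.h :=
  le_ciSup (f := fun j : Fin M.m => M.x (j + 1) - M.x j) (Set.finite_range _).bddAbove ⟨j, hj⟩

lemma h_pos : 0 < M.h :=
  (sub_pos.2 (M.x_lt 0 M.m_pos)).trans_le (M.sub_le_h M.m_pos)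

lemma sub_pred_le_h {i : ℕ} (hi : i ≤ M.m) : M.x i - M.x (i - 1) ≤ M.h := by
  cases i with
  | zero => simpa only [Nat.zero_sub, sub_self] using M.h_pos.le
  | succ i => exact M.sub_le_h hi

lemma exists_mem_element {y : ℝ} (hy : y ∈ Icc (0 : ℝ) 1) :
    ∃ j < M.m, y ∈ Icc (M.x j) (M.x (j + 1)) := by
  have key (k : ℕ) (hk : 1 ≤ k) : y ≤ M.x k → ∃ j < k, y ∈ Icc (M.x j) (M.x (j + 1)) := by
    induction k, hk using Nat.le_induction with
    | base => exact fun hyk => ⟨0, one_pos, M.x_zero.trans_le hy.1, hyk⟩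
    | succ k _ ih =>
      intro hyk
      rcases le_total y (M.x k) with hle | hle
      · obtain ⟨j, hj, hyj⟩ := ih hle
        exact ⟨j, hj.trans k.lt_succ_self, hyj⟩
      · exact ⟨k, k.lt_succ_self, hle, hyk⟩
  exact key M.m M.m_pos (hy.2.trans M.x_last.ge)

end

variable {M : Mesh} {i j : ℕ} {y : ℝ}

lemma hat_nonneg : 0 ≤ M.hat i y := by
  rw [hat]; split_ifs <;> exact le_max_left _ _

lemma hat_right (hi : i < M.m) (hy : y ∈ Icc (M.x i) (M.x (i + 1))) :
    M.hat i y = (M.x (i + 1) - y) / (M.x (i + 1) - M.x i) := by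
  rw [hat, if_pos hy.1, max_eq_right]
  exact div_nonneg (sub_nonneg.2 hy.2) (sub_nonneg.2 (M.x_lt i hi).le)

lemma hat_left (hy : y ∈ Ico (M.x (i - 1)) (M.x i)) :
    M.hat i y = (y - M.x (i - 1)) / (M.x i - M.x (i - 1)) := by
  rw [hat, if_neg hy.2.not_ge, max_eq_right]
  exact div_nonneg (sub_nonneg.2 hy.1) (sub_nonneg.2 (hy.1.trans hy.2.le))

lemma hat_eq_zero_of_ge (hi : i < M.m) (hy : M.x (i + 1) ≤ y) : M.hat i y = 0 := by
  have hlt := M.x_lt i hi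
  rw [hat, if_pos (hlt.le.trans hy), max_eq_left]
  exact div_nonpos_of_nonpos_of_nonneg (sub_nonpos.2 hy) (sub_nonneg.2 hlt.le)

lemma hat_eq_zero_of_le (hi : i < M.m) (hy : y ≤ M.x (i - 1)) (hy' : y < M.x i) :
    M.hat i y = 0 := by
  rw [hat, if_neg hy'.not_ge, max_eq_left]
  exact div_nonpos_of_nonpos_of_nonneg (sub_nonpos.2 hy) (sub_nonneg.2 (M.x_pred_le hi.le))

lemma hat_eq_zero_of_notMem (hi : i < M.m) (hy : y ∉ Icc (M.x (i - 1)) (M.x (i + 1))) :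
    M.hat i y = 0 := by
  rcases lt_or_ge y (M.x (i - 1)) with hlt | hge
  · exact hat_eq_zero_of_le hi hlt.le (hlt.trans_le (M.x_pred_le hi.le))
  · exact hat_eq_zero_of_ge hi (not_le.1 fun hle => hy ⟨hge, hle⟩).le

lemma abs_sub_le_h_of_hat_ne_zero (hi : i < M.m) (hy : M.hat i y ≠ 0) :
    |y - M.x i| ≤ M.h := by
  have hmem := not_imp_comm.1 (hat_eq_zero_of_notMem hi) hy
  rw [abs_le]
  constructor
  · linarith [hmem.1, M.sub_pred_le_h hi.le]
  · linarith [hmem.2, M.sub_le_h hi]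

lemma hat_self (hi : i < M.m) : M.hat i (M.x i) = 1 := by
  rw [hat_right hi ⟨le_rfl, (M.x_lt i hi).le⟩, div_self (sub_pos.2 (M.x_lt i hi)).ne']

lemma hat_of_ne (hi : i < M.m) (hj : j ≤ M.m) (hij : j ≠ i) : M.hat i (M.x j) = 0 := by
  rcases hij.lt_or_gt with h | h
  · exact hat_eq_zero_of_le hi (M.x_mono (by omega) (by omega)) (M.x_lt_x h hi.le)
  · exact hat_eq_zero_of_ge hi (M.x_mono h hj)

lemma continuousOn_hat (hi : i < M.m) : ContinuousOn (M.hat i) (Icc 0 1) := by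
  have hR : Continuous fun y => max 0 ((M.x (i + 1) - y) / (M.x (i + 1) - M.x i)) := by fun_prop
  rcases Nat.eq_zero_or_pos i with rfl | h0
  · exact hR.continuousOn.congr fun y hy => by rw [hat, if_pos (M.x_zero.trans_le hy.1)]
  · have hL : Continuous fun y => max 0 ((y - M.x (i - 1)) / (M.x i - M.x (i - 1))) := by fun_prop
    refine (hR.if_le hL continuous_const continuous_id ?_).continuousOn
    rintro _ rfl
    rw [div_self (sub_pos.2 (M.x_lt i hi)).ne',
      div_self (sub_pos.2 (M.x_lt_x (i.sub_one_lt h0.ne') hi.le)).ne']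

lemma hat_mem_space (hi : i < M.m) : M.hat i ∈ M.space := by
  refine ⟨continuousOn_hat hi, fun j hj => ?_, M.x_last ▸ hat_of_ne hi le_rfl hi.ne'⟩
  by_cases hleft : j + 1 = i
  · subst hleft
    refine ⟨-M.x j / (M.x (j + 1) - M.x j), 1 / (M.x (j + 1) - M.x j), fun y hy => ?_⟩
    rw [hat_left (i := j + 1) ⟨hy.1.le, hy.2⟩, Nat.add_sub_cancel]
    ring
  by_cases hright : j = i
  · subst hright
    refine ⟨M.x (j + 1) / (M.x (j + 1) - M.x j), -1 / (M.x (j + 1) - M.x j), fun y hy => ?_⟩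
    rw [hat_right hi ⟨hy.1.le, hy.2.le⟩]
    ring
  refine ⟨0, 0, fun y hy => ?_⟩
  rw [zero_mul, add_zero]
  rcases lt_or_gt_of_ne hright with h | h
  · exact hat_eq_zero_of_le hi (hy.2.le.trans (M.x_mono (by omega) (by omega)))
      (hy.2.trans (M.x_lt_x (by omega) hi.le))
  · exact hat_eq_zero_of_ge hi ((M.x_mono h hj.le).trans hy.1.le)

lemma deriv_hat_of_notMem (hi : i < M.m) (hy : y ∉ Icc (M.x (i - 1)) (M.x (i + 1))) :
    deriv (M.hat i) y = 0 := by
  have hzero : M.hat i =ᶠ[nhds y] fun _ => 0 := by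
    filter_upwards [isClosed_Icc.isOpen_compl.mem_nhds hy] with z hz
    exact hat_eq_zero_of_notMem hi hz
  rw [hzero.deriv_eq, deriv_const]

section Space

variable {w : ℝ → ℝ} (hw : w ∈ M.space)
include hw

lemma apply_last_of_mem_space : w (M.x M.m) = 0 := by
  rw [M.x_last, hw.2.2]

lemma apply_of_mem_space (hj : j < M.m) (hy : y ∈ Icc (M.x j) (M.x (j + 1))) :
    w y = w (M.x j) +
      (w (M.x (j + 1)) - w (M.x j)) / (M.x (j + 1) - M.x j) * (y - M.x j) := by
  obtain ⟨a, b, hab⟩ := hw.2.1 j hj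
  have hlt := M.x_lt j hj
  have key : EqOn w (fun y => a + b * y) (Icc (M.x j) (M.x (j + 1))) :=
    EqOn.of_subset_closure hab (hw.1.mono (M.Icc_subset hj.le hj)) (by fun_prop)
      Ioo_subset_Icc_self (closure_Ioo hlt.ne).ge
  have hd : M.x (j + 1) - M.x j ≠ 0 := (sub_pos.2 hlt).ne'
  rw [key hy, key ⟨le_rfl, hlt.le⟩, key ⟨hlt.le, le_rfl⟩]
  field_simp
  ring

lemma hasDerivAt_of_mem_space (hj : j < M.m) (hy : y ∈ Ioo (M.x j) (M.x (j + 1))) :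
    HasDerivAt w ((w (M.x (j + 1)) - w (M.x j)) / (M.x (j + 1) - M.x j)) y := by
  have haffine := (((hasDerivAt_id y).sub_const (M.x j)).const_mul
    ((w (M.x (j + 1)) - w (M.x j)) / (M.x (j + 1) - M.x j))).const_add (w (M.x j))
  rw [mul_one] at haffine
  refine haffine.congr_of_eventuallyEq ?_
  filter_upwards [Ioo_mem_nhds hy.1 hy.2] with z hz
  exact apply_of_mem_space hw hj ⟨hz.1.le, hz.2.le⟩

lemma abs_sub_le_of_nodal {v : ℝ → ℝ} {K : ℝ≥0} {e : ℝ}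
    (hv : LipschitzOnWith K v (Icc 0 1)) (he : ∀ i ≤ M.m, |w (M.x i) - v (M.x i)| ≤ e)
    (hy : y ∈ Icc 0 1) : |w y - v y| ≤ e + K * M.h := by
  obtain ⟨j, hj, hyj⟩ := M.exists_mem_element hy
  have hlen : 0 < M.x (j + 1) - M.x j := sub_pos.2 (M.x_lt j hj)
  set s := (y - M.x j) / (M.x (j + 1) - M.x j) with hs
  have hs0 : 0 ≤ s := div_nonneg (sub_nonneg.2 hyj.1) hlen.le
  have hs1 : s ≤ 1 := (div_le_one hlen).2 (by linarith [hyj.2])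
  have hnode (k : ℕ) (hk : k ≤ M.m) (hky : |M.x k - y| ≤ M.h) :
      |w (M.x k) - v y| ≤ e + K * M.h := by
    have hlip : |v (M.x k) - v y| ≤ K * |M.x k - y| := hv.dist_le_mul _ (M.x_mem hk) _ hy
    calc |w (M.x k) - v y| ≤ |w (M.x k) - v (M.x k)| + |v (M.x k) - v y| := abs_sub_le _ _ _
      _ ≤ e + K * M.h := add_le_add (he k hk) (hlip.trans (by gcongr))
  have hconv : w y - v y =
      (1 - s) * (w (M.x j) - v y) + s * (w (M.x (j + 1)) - v y) := by
    rw [apply_of_mem_space hw hj hyj, hs]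
    ring
  have hl := hnode j hj.le (abs_le.2 (by constructor <;> linarith [hyj.1, hyj.2, M.sub_le_h hj]))
  have hr := hnode (j + 1) hj (abs_le.2 (by constructor <;> linarith [hyj.1, hyj.2, M.sub_le_h hj]))
  rw [hconv, ← smul_eq_mul, ← smul_eq_mul]
  have hball : Convex ℝ (Icc (-(e + K * M.h)) (e + K * M.h)) := convex_Icc _ _
  exact abs_le.2 (hball (abs_le.1 hl) (abs_le.1 hr) (sub_nonneg.2 hs1) hs0 (sub_add_cancel 1 s))

end Space

end Mesh

/-! ### Integrals against hat functions -/

lemma integral_patch {M : Mesh} {i : ℕ} (hi : i < M.m) {G gl gr : ℝ → ℝ}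
    (h0 : ∀ y ∉ Icc (M.x (i - 1)) (M.x (i + 1)), G y = 0)
    (hl : EqOn G gl (Ioo (M.x (i - 1)) (M.x i))) (hr : EqOn G gr (Ioo (M.x i) (M.x (i + 1))))
    (cl : ContinuousOn gl (Icc (M.x (i - 1)) (M.x i)))
    (cr : ContinuousOn gr (Icc (M.x i) (M.x (i + 1)))) :
    ∫ y in (0 : ℝ)..1, G y =
      (∫ y in M.x (i - 1)..M.x i, gl y) + ∫ y in M.x i..M.x (i + 1), gr y := by
  have l0 : 0 ≤ M.x (i - 1) := (M.x_mem (by omega)).1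
  have l1 : M.x (i - 1) ≤ M.x i := M.x_pred_le hi.le
  have l2 : M.x i ≤ M.x (i + 1) := (M.x_lt i hi).le
  have l3 : M.x (i + 1) ≤ 1 := (M.x_mem hi).2
  have hleft : EqOn G 0 (Ioo 0 (M.x (i - 1))) := fun y hy => h0 y fun h => hy.2.not_ge h.1
  have hright : EqOn G 0 (Ioo (M.x (i + 1)) 1) := fun y hy => h0 y fun h => hy.1.not_ge h.2
  have integrable {a b : ℝ} {g : ℝ → ℝ} (hab : a ≤ b) (hg : EqOn G g (Ioo a b))
      (hc : ContinuousOn g (Icc a b)) : IntervalIntegrable G MeasureTheory.volume a b :=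
    (hc.intervalIntegrable_of_Icc hab).congr_uIoo (by rw [uIoo_of_le hab]; exact hg.symm)
  have i0 := integrable l0 hleft continuousOn_const
  have i1 := integrable l1 hl cl
  have i2 := integrable l2 hr cr
  have i3 := integrable l3 hright continuousOn_const
  rw [← intervalIntegral.integral_add_adjacent_intervals i0 ((i1.trans i2).trans i3),
    ← intervalIntegral.integral_add_adjacent_intervals (i1.trans i2) i3,
    ← intervalIntegral.integral_add_adjacent_intervals i1 i2,
    intervalIntegral.integral_congr_Ioo_of_le l0 hleft,
    intervalIntegral.integral_congr_Ioo_of_le l1 hl,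
    intervalIntegral.integral_congr_Ioo_of_le l2 hr,
    intervalIntegral.integral_congr_Ioo_of_le l3 hright]
  simp only [Pi.zero_apply, intervalIntegral.integral_zero, zero_add, add_zero]

/-- The weighted length `∫ₐᵇ y^{N-1} dy` of the element `[a, b]`. -/
noncomputable def weight (N : ℕ) (a b : ℝ) : ℝ := ∫ y in a..b, y ^ (N - 1)

/-- The stiffness coefficient of the element `[a, b]`. By the convention `x / 0 = 0` it vanishes
for `a = b`, so that the fictitious element `[x_{i-1}, x_i]` to the left of `x_0` does not
contribute. -/
noncomputable def stiffness (N : ℕ) (a b : ℝ) : ℝ := weight N a b / (b - a) ^ 2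

/-- The lumped mass `(1, φ_i)` of the `i`-th node. -/
noncomputable def mass (N : ℕ) (M : Mesh) (i : ℕ) : ℝ := wInner N (fun _ => 1) (M.hat i)

/-- The discrete radial Laplacian, `-A(w, φ_i)` in terms of the nodal values `W j = w (x_j)`. -/
noncomputable def fluxDiff (N : ℕ) (M : Mesh) (W : ℕ → ℝ) (i : ℕ) : ℝ :=
  stiffness N (M.x i) (M.x (i + 1)) * (W (i + 1) - W i) -
    stiffness N (M.x (i - 1)) (M.x i) * (W i - W (i - 1))

lemma weight_pos {N : ℕ} {a b : ℝ} (ha : 0 ≤ a) (hab : a < b) : 0 < weight N a b :=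
  intervalIntegral.intervalIntegral_pos_of_pos_on
    ((continuous_pow (N - 1)).intervalIntegrable a b)
    (fun _ hy => pow_pos (ha.trans_lt hy.1) _) hab

lemma stiffness_self (N : ℕ) (a : ℝ) : stiffness N a a = 0 := by
  rw [stiffness, sub_self, zero_pow two_ne_zero, div_zero]

lemma stiffness_pos {N : ℕ} {a b : ℝ} (ha : 0 ≤ a) (hab : a < b) : 0 < stiffness N a b :=
  div_pos (weight_pos ha hab) (pow_pos (sub_pos.2 hab) 2)

lemma stiffness_nonneg {N : ℕ} {a b : ℝ} (ha : 0 ≤ a) (hab : a ≤ b) : 0 ≤ stiffness N a b := by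
  rcases hab.eq_or_lt with rfl | hlt
  · exact (stiffness_self N a).ge
  · exact (stiffness_pos ha hlt).le

lemma mass_eq_integral (N : ℕ) (M : Mesh) (i : ℕ) :
    mass N M i = ∫ y in (0 : ℝ)..1, y ^ (N - 1) * M.hat i y := by
  simp only [mass, wInner, one_mul]

section Hat

variable {N : ℕ} {M : Mesh} {i : ℕ} (hi : i < M.m)
include hi

lemma stiffness_left_nonneg : 0 ≤ stiffness N (M.x (i - 1)) (M.x i) :=
  stiffness_nonneg (M.x_mem (by omega)).1 (M.x_pred_le hi.le)

lemma stiffness_right_pos : 0 < stiffness N (M.x i) (M.x (i + 1)) :=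
  stiffness_pos (M.x_mem hi.le).1 (M.x_lt i hi)

lemma continuousOn_pow_mul_hat :
    ContinuousOn (fun y => y ^ (N - 1) * M.hat i y) (Icc 0 1) :=
  (continuousOn_pow _).mul (Mesh.continuousOn_hat hi)

lemma mass_pos : 0 < mass N M i := by
  rw [mass_eq_integral]
  have hx := (M.x_mem hi.le).1
  have hlt := M.x_lt i hi
  refine intervalIntegral.integral_pos one_pos (continuousOn_pow_mul_hat hi)
    (fun y hy => mul_nonneg (pow_nonneg hy.1.le _) Mesh.hat_nonneg)
    ⟨(M.x i + M.x (i + 1)) / 2, M.Icc_subset hi.le hi ⟨by linarith, by linarith⟩, ?_⟩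
  rw [Mesh.hat_right hi ⟨by linarith, by linarith⟩]
  exact mul_pos (pow_pos (by linarith) _) (div_pos (by linarith) (by linarith))

lemma wInner_hat {g : ℝ → ℝ} (hg : ContinuousOn g (Icc 0 1)) :
    wInner N g (M.hat i) =
      (∫ y in M.x (i - 1)..M.x i,
        y ^ (N - 1) * (g y * ((y - M.x (i - 1)) / (M.x i - M.x (i - 1))))) +
      ∫ y in M.x i..M.x (i + 1),
        y ^ (N - 1) * (g y * ((M.x (i + 1) - y) / (M.x (i + 1) - M.x i))) := by
  have hi' : i - 1 ≤ M.m := by omega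
  refine integral_patch hi (fun y hy => ?_) (fun y hy => ?_) (fun y hy => ?_)
    ((continuousOn_pow _).mul ((hg.mono (M.Icc_subset hi' hi.le)).mul (by fun_prop)))
    ((continuousOn_pow _).mul ((hg.mono (M.Icc_subset hi.le hi)).mul (by fun_prop)))
  · rw [Mesh.hat_eq_zero_of_notMem hi hy, mul_zero, mul_zero]
  · simp only [Mesh.hat_left ⟨hy.1.le, hy.2⟩]
  · simp only [Mesh.hat_right hi ⟨hy.1.le, hy.2.le⟩]

lemma abs_wInner_hat_sub_le {B : ℝ≥0} {g : ℝ → ℝ} (hg : LipschitzOnWith B g (Icc 0 1)) :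
    |wInner N g (M.hat i) - mass N M i * g (M.x i)| ≤ mass N M i * (B * M.h) := by
  have hosc (y : ℝ) (hy : y ∈ Icc (0 : ℝ) 1) (hne : y ^ (N - 1) * M.hat i y ≠ 0) :
      |g y - g (M.x i)| ≤ B * M.h :=
    (hg.dist_le_mul y hy _ (M.x_mem hi.le)).trans
      (by gcongr; exact Mesh.abs_sub_le_h_of_hat_ne_zero hi (right_ne_zero_of_mul hne))
  have hint := abs_integral_mul_sub_le zero_le_one (continuousOn_pow_mul_hat (N := N) hi)
    (fun y hy => mul_nonneg (pow_nonneg hy.1 _) Mesh.hat_nonneg) hg.continuousOn hosc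
  rw [← mass_eq_integral, mul_comm (g _), mul_comm (B * M.h : ℝ)] at hint
  simpa only [wInner, mul_comm (g _), mul_assoc] using hint

lemma lumped_hat (w : ℝ → ℝ) : M.lumped N w (M.hat i) = w (M.x i) * mass N M i := by
  rw [Mesh.lumped, Finset.sum_eq_single_of_mem i (Finset.mem_range.2 hi), Mesh.hat_self hi, mass,
    mul_one]
  intro j hj hji
  rw [Mesh.hat_of_ne hi (Finset.mem_range.1 hj).le hji, mul_zero, zero_mul]

lemma aForm_hat {w : ℝ → ℝ} (hw : w ∈ M.space) :
    aForm N w (M.hat i) = -fluxDiff N M (fun j => w (M.x j)) i := by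
  have hφ := Mesh.hat_mem_space hi
  have main := integral_patch hi
    (G := fun y => y ^ (N - 1) * (deriv w y * deriv (M.hat i) y))
    (gl := fun y => y ^ (N - 1) * ((w (M.x i) - w (M.x (i - 1))) / (M.x i - M.x (i - 1)) *
      (1 / (M.x i - M.x (i - 1)))))
    (gr := fun y => y ^ (N - 1) * ((w (M.x (i + 1)) - w (M.x i)) / (M.x (i + 1) - M.x i) *
      (-1 / (M.x (i + 1) - M.x i))))
    (fun y hy => ?_) (fun y hy => ?_) (fun y hy => ?_) (by fun_prop) (by fun_prop)
  · rw [aForm, main, intervalIntegral.integral_mul_const, intervalIntegral.integral_mul_const,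
      fluxDiff, stiffness, stiffness, weight, weight]
    simp only [div_eq_mul_inv, ← inv_pow]
    ring
  · rw [Mesh.deriv_hat_of_notMem hi hy, mul_zero, mul_zero]
  · cases i with
    | zero => exact absurd (hy.1.trans hy.2) (lt_irrefl _)
    | succ k =>
      simp only [Nat.add_sub_cancel] at hy ⊢
      have hk : k < M.m := by omega
      rw [(Mesh.hasDerivAt_of_mem_space hw hk hy).deriv,
        (Mesh.hasDerivAt_of_mem_space hφ hk hy).deriv, Mesh.hat_self hi,
        Mesh.hat_of_ne hi hk.le (by omega), sub_zero]
  · simp only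
    rw [(Mesh.hasDerivAt_of_mem_space hw hi hy).deriv,
      (Mesh.hasDerivAt_of_mem_space hφ hi hy).deriv, Mesh.hat_self hi,
      Mesh.hat_of_ne hi hi (by omega), zero_sub]

lemma aForm_hat_self : aForm N (M.hat i) (M.hat i) =
    stiffness N (M.x (i - 1)) (M.x i) + stiffness N (M.x i) (M.x (i + 1)) := by
  rw [aForm_hat hi (Mesh.hat_mem_space hi), fluxDiff, Mesh.hat_self hi,
    Mesh.hat_of_ne hi hi (by omega)]
  cases i with
  | zero => rw [stiffness_self]; ring
  | succ k =>
    rw [Nat.add_sub_cancel, Mesh.hat_of_ne hi (j := k) (by omega) (by omega)]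
    ring

lemma tau_mul_stiffness_le_mass {G : TimeGrid} (hG : StepRestriction N M G) :
    G.tau * (stiffness N (M.x (i - 1)) (M.x i) + stiffness N (M.x i) (M.x (i + 1))) ≤
      mass N M i := by
  have hτ := hG i hi
  rwa [aForm_hat_self hi, le_div_iff₀
    (add_pos_of_nonneg_of_pos (stiffness_left_nonneg hi) (stiffness_right_pos hi))] at hτ

lemma IsML2Solution.nodal {f : ℝ → ℝ} {G : TimeGrid} {uh : ℕ → ℝ → ℝ}
    (hsol : IsML2Solution N f M G uh) (n : ℕ) :
    mass N M i * (uh (n + 1) (M.x i) - uh n (M.x i)) =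
      G.step n * (fluxDiff N M (fun j => uh n (M.x j)) i + mass N M i * f (uh n (M.x i))) := by
  have hscheme := hsol.scheme n _ (Mesh.hat_mem_space hi)
  rw [lumped_hat hi, lumped_hat hi, aForm_hat hi (hsol.mem n)] at hscheme
  have hs := (G.step_pos n).ne'
  field_simp at hscheme
  linear_combination hscheme

end Hat

/-! ### The Ritz projection -/

/-- The mean value of `g` on `[a, b]` with respect to the weight `y^{N-1}`. -/
noncomputable def radialMean (N : ℕ) (a b : ℝ) (g : ℝ → ℝ) : ℝ :=
  (∫ y in a..b, y ^ (N - 1) * g y) / weight N a b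

/-- The nodal values of the Ritz projection of a function `v` with derivative `v'` and `v 1 = 0`,
the element of the finite element space whose slope on each element is the weighted mean of `v'`. It
depends on `v` through `v'` only. -/
noncomputable def ritz (N : ℕ) (M : Mesh) (v' : ℝ → ℝ) (i : ℕ) : ℝ :=
  -∑ j ∈ Finset.Ico i M.m, (M.x (j + 1) - M.x j) * radialMean N (M.x j) (M.x (j + 1)) v'

section RadialMean

variable {N : ℕ} {a b : ℝ} {g : ℝ → ℝ}

lemma radialMean_sub {g₁ g₂ : ℝ → ℝ} (hab : a ≤ b) (hg₁ : ContinuousOn g₁ (Icc a b))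
    (hg₂ : ContinuousOn g₂ (Icc a b)) :
    radialMean N a b (fun y => g₁ y - g₂ y) = radialMean N a b g₁ - radialMean N a b g₂ := by
  have integrable {g : ℝ → ℝ} (hg : ContinuousOn g (Icc a b)) :
      IntervalIntegrable (fun y => y ^ (N - 1) * g y) MeasureTheory.volume a b :=
    ((continuousOn_pow _).mul hg).intervalIntegrable_of_Icc hab
  simp only [radialMean, mul_sub]
  rw [intervalIntegral.integral_sub (integrable hg₁) (integrable hg₂), sub_div]

lemma stiffness_mul_radialMean (ha : 0 ≤ a) (hab : a ≤ b) :
    stiffness N a b * ((b - a) * radialMean N a b g) =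
      (∫ y in a..b, y ^ (N - 1) * g y) / (b - a) := by
  rcases hab.eq_or_lt with rfl | hlt
  · rw [sub_self, zero_mul, mul_zero, div_zero]
  have hw := (weight_pos (N := N) ha hlt).ne'
  have hd := (sub_pos.2 hlt).ne'
  rw [stiffness, radialMean]
  field_simp

lemma abs_radialMean_sub_le {c δ : ℝ} (ha : 0 ≤ a) (hab : a < b)
    (hg : ContinuousOn g (Icc a b)) (hδ : ∀ y ∈ Icc a b, |g y - c| ≤ δ) :
    |radialMean N a b g - c| ≤ δ := by
  have hw := weight_pos (N := N) ha hab
  rw [radialMean, div_sub' hw.ne', abs_div, abs_of_pos hw, div_le_iff₀ hw, mul_comm _ c]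
  exact abs_integral_mul_sub_le hab.le (continuousOn_pow _)
    (fun y hy => pow_nonneg (ha.trans hy.1) _) hg (fun y hy _ => hδ y hy)

lemma abs_mul_radialMean_sub_le {B : ℝ≥0} {v v' : ℝ → ℝ} (ha : 0 ≤ a) (hab : a < b)
    (hv : ∀ x ∈ Icc a b, HasDerivWithinAt v (v' x) (Icc a b) x)
    (hB : LipschitzOnWith B v' (Icc a b)) :
    |(b - a) * radialMean N a b v' - (v b - v a)| ≤ B * (b - a) ^ 2 := by
  obtain ⟨ξ, hξ, hmean⟩ := exists_sub_eq_mul_deriv hab.le hv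
  have hosc (y : ℝ) (hy : y ∈ Icc a b) : |v' y - v' ξ| ≤ B * (b - a) :=
    (hB.dist_le_mul y hy ξ hξ).trans (by gcongr; exact Real.dist_le_of_mem_Icc hy hξ)
  have hba := sub_pos.2 hab
  rw [hmean, ← mul_sub, abs_mul, abs_of_pos hba]
  calc (b - a) * |radialMean N a b v' - v' ξ| ≤ (b - a) * (B * (b - a)) := by
        gcongr
        exact abs_radialMean_sub_le ha hab hB.continuousOn hosc
    _ = B * (b - a) ^ 2 := by ring

end RadialMean

section Ritz

variable {N : ℕ} {M : Mesh} {v v' : ℝ → ℝ} {i : ℕ}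

lemma ritz_last (N : ℕ) (M : Mesh) (v' : ℝ → ℝ) : ritz N M v' M.m = 0 := by
  rw [ritz, Finset.Ico_self, Finset.sum_empty, neg_zero]

lemma ritz_succ_sub (hi : i < M.m) : ritz N M v' (i + 1) - ritz N M v' i =
    (M.x (i + 1) - M.x i) * radialMean N (M.x i) (M.x (i + 1)) v' := by
  rw [ritz, ritz, Finset.sum_eq_sum_Ico_succ_bot hi]
  ring

lemma stiffness_mul_ritz_succ_sub (hi : i < M.m) :
    stiffness N (M.x i) (M.x (i + 1)) * (ritz N M v' (i + 1) - ritz N M v' i) =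
      (∫ y in M.x i..M.x (i + 1), y ^ (N - 1) * v' y) / (M.x (i + 1) - M.x i) := by
  rw [ritz_succ_sub hi, stiffness_mul_radialMean (M.x_mem hi.le).1 (M.x_lt i hi).le]

lemma ritz_sub {w' : ℝ → ℝ} (hv : ContinuousOn v' (Icc 0 1)) (hw : ContinuousOn w' (Icc 0 1)) :
    ritz N M (fun y => v' y - w' y) i = ritz N M v' i - ritz N M w' i := by
  rw [ritz, ritz, ritz, neg_sub_neg, ← Finset.sum_sub_distrib, ← Finset.sum_neg_distrib]
  refine Finset.sum_congr rfl fun j hj => ?_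
  have hj' := (Finset.mem_Ico.1 hj).2
  have hsub := M.Icc_subset hj'.le hj'
  rw [radialMean_sub (M.x_lt j hj').le (hv.mono hsub) (hw.mono hsub)]
  ring

lemma abs_ritz_sub_le {B : ℝ≥0}
    (hv : ∀ x ∈ Icc (0 : ℝ) 1, HasDerivWithinAt v (v' x) (Icc 0 1) x)
    (hB : LipschitzOnWith B v' (Icc 0 1)) (hv1 : v 1 = 0) (hi : i ≤ M.m) :
    |ritz N M v' i - v (M.x i)| ≤ B * M.h := by
  have key : |ritz N M v' i - v (M.x i)| ≤ B * M.h * (1 - M.x i) := by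
    induction hi using Nat.decreasingInduction with
    | self => simp only [ritz_last, M.x_last, hv1, sub_self, abs_zero, mul_zero, le_refl]
    | of_succ j hj ih =>
      have hsub := M.Icc_subset hj.le hj
      have hlocal := abs_mul_radialMean_sub_le (N := N) (M.x_mem hj.le).1 (M.x_lt j hj)
        (fun x hx => (hv x (hsub hx)).mono hsub) (hB.mono hsub)
      rw [← ritz_succ_sub hj] at hlocal
      have hd := sub_pos.2 (M.x_lt j hj)
      calc |ritz N M v' j - v (M.x j)|
          = |ritz N M v' (j + 1) - v (M.x (j + 1)) -
            (ritz N M v' (j + 1) - ritz N M v' j - (v (M.x (j + 1)) - v (M.x j)))| := by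
            congr 1; ring
        _ ≤ B * M.h * (1 - M.x (j + 1)) + B * (M.x (j + 1) - M.x j) ^ 2 :=
            (abs_sub _ _).trans (add_le_add ih hlocal)
        _ ≤ B * M.h * (1 - M.x (j + 1)) + B * (M.h * (M.x (j + 1) - M.x j)) := by
            rw [sq]; gcongr; exact M.sub_le_h hj
        _ = B * M.h * (1 - M.x j) := by ring
  refine key.trans (mul_le_of_le_one_right (mul_nonneg B.coe_nonneg M.h_pos.le) ?_)
  linarith [(M.x_mem hi).1]

end Ritz

section Consistency

variable {N : ℕ} (hN : 1 ≤ N) {v g : ℝ → ℝ}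
include hN

lemma hasDerivAt_flux {x : ℝ} (hx : x ≠ 0)
    (hv : HasDerivAt v (g x - ((N : ℝ) - 1) / x * v x) x) :
    HasDerivAt (fun y => y ^ (N - 1) * v y) (x ^ (N - 1) * g x) x := by
  refine ((hasDerivAt_pow (N - 1) x).mul hv).congr_deriv ?_
  obtain ⟨k, rfl⟩ := Nat.exists_eq_add_of_le' hN
  cases k with
  | zero => simp
  | succ k =>
    simp only [Nat.add_sub_cancel]
    push_cast
    field_simp
    ring

lemma integral_flux_mul_affine {a b d : ℝ} (ha : 0 ≤ a) (hab : a ≤ b) {φ : ℝ → ℝ}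
    (hv : ContinuousOn v (Icc a b)) (hg : ContinuousOn g (Icc a b))
    (hvg : ∀ x ∈ Ioo a b, HasDerivAt v (g x - ((N : ℝ) - 1) / x * v x) x)
    (hφ : ∀ x, HasDerivAt φ d x) :
    ∫ y in a..b, y ^ (N - 1) * (g y * φ y) =
      b ^ (N - 1) * v b * φ b - a ^ (N - 1) * v a * φ a -
        d * ∫ y in a..b, y ^ (N - 1) * v y := by
  have hφc : Continuous φ := continuous_iff_continuousAt.2 fun x => (hφ x).continuousAt
  have hi₁ : IntervalIntegrable (fun y => y ^ (N - 1) * (g y * φ y))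
      MeasureTheory.volume a b :=
    ContinuousOn.intervalIntegrable_of_Icc hab (by fun_prop)
  have hi₂ : IntervalIntegrable (fun y => d * (y ^ (N - 1) * v y)) MeasureTheory.volume a b :=
    ContinuousOn.intervalIntegrable_of_Icc hab (by fun_prop)
  rw [eq_sub_iff_add_eq, ← intervalIntegral.integral_const_mul,
    ← intervalIntegral.integral_add hi₁ hi₂]
  refine intervalIntegral.integral_eq_sub_of_hasDerivAt_of_le hab
    (f := fun y => y ^ (N - 1) * v y * φ y) (by fun_prop) (fun x hx => ?_) (hi₁.add hi₂)
  refine ((hasDerivAt_flux hN (ha.trans_lt hx.1).ne' (hvg x hx)).mul (hφ x)).congr_deriv ?_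
  ring

lemma integral_mul_ramp_down {a b : ℝ} (ha : 0 ≤ a) (hab : a < b)
    (hv : ContinuousOn v (Icc a b)) (hg : ContinuousOn g (Icc a b))
    (hvg : ∀ x ∈ Ioo a b, HasDerivAt v (g x - ((N : ℝ) - 1) / x * v x) x) :
    ∫ y in a..b, y ^ (N - 1) * (g y * ((b - y) / (b - a))) =
      (∫ y in a..b, y ^ (N - 1) * v y) / (b - a) - a ^ (N - 1) * v a := by
  have hφ (x : ℝ) : HasDerivAt (fun y => (b - y) / (b - a)) (-1 / (b - a)) x :=
    ((hasDerivAt_id x).const_sub b).div_const (b - a)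
  rw [integral_flux_mul_affine hN ha hab.le hv hg hvg hφ, sub_self, zero_div,
    div_self (sub_pos.2 hab).ne']
  ring

lemma integral_mul_ramp_up {a b : ℝ} (ha : 0 ≤ a) (hab : a < b)
    (hv : ContinuousOn v (Icc a b)) (hg : ContinuousOn g (Icc a b))
    (hvg : ∀ x ∈ Ioo a b, HasDerivAt v (g x - ((N : ℝ) - 1) / x * v x) x) :
    ∫ y in a..b, y ^ (N - 1) * (g y * ((y - a) / (b - a))) =
      b ^ (N - 1) * v b - (∫ y in a..b, y ^ (N - 1) * v y) / (b - a) := by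
  have hφ (x : ℝ) : HasDerivAt (fun y => (y - a) / (b - a)) (1 / (b - a)) x :=
    ((hasDerivAt_id x).sub_const a).div_const (b - a)
  rw [integral_flux_mul_affine hN ha hab.le hv hg hvg hφ, sub_self, zero_div,
    div_self (sub_pos.2 hab).ne']
  ring

lemma fluxDiff_ritz {M : Mesh} {i : ℕ} (hi : i < M.m) (hv : ContinuousOn v (Icc 0 1))
    (hv0 : v 0 = 0) (hg : ContinuousOn g (Icc 0 1))
    (hvg : ∀ x ∈ Ioo (0 : ℝ) 1, HasDerivAt v (g x - ((N : ℝ) - 1) / x * v x) x) :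
    fluxDiff N M (ritz N M v) i = wInner N g (M.hat i) := by
  have hvg' {j k : ℕ} (hj : j ≤ M.m) (hk : k ≤ M.m) (x : ℝ) (hx : x ∈ Ioo (M.x j) (M.x k)) :=
    hvg x ⟨(M.x_mem hj).1.trans_lt hx.1, hx.2.trans_le (M.x_mem hk).2⟩
  have hsub := M.Icc_subset hi.le hi
  have hright := integral_mul_ramp_down hN (M.x_mem hi.le).1 (M.x_lt i hi) (hv.mono hsub)
    (hg.mono hsub) (hvg' hi.le hi)
  rw [wInner_hat hi hg, fluxDiff, stiffness_mul_ritz_succ_sub hi, hright]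
  cases i with
  | zero =>
    rw [Nat.zero_sub, stiffness_self, zero_mul, intervalIntegral.integral_same, M.x_zero, hv0]
    ring
  | succ k =>
    have hk : k < M.m := by omega
    have hsub' := M.Icc_subset hk.le hk
    rw [Nat.add_sub_cancel, stiffness_mul_ritz_succ_sub hk,
      integral_mul_ramp_up hN (M.x_mem hk.le).1 (M.x_lt k hk) (hv.mono hsub') (hg.mono hsub')
        (hvg' hk.le hk)]
    ring

end Consistency

/-! ### The error recursion -/

namespace TimeGrid

variable (G : TimeGrid)

lemma time_zero : G.time 0 = 0 := Finset.sum_range_zero _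

lemma time_succ (n : ℕ) : G.time (n + 1) = G.time n + G.step n := Finset.sum_range_succ _ _

lemma time_nonneg (n : ℕ) : 0 ≤ G.time n := Finset.sum_nonneg fun j _ => (G.step_pos j).le

lemma time_le_time_succ (n : ℕ) : G.time n ≤ G.time (n + 1) :=
  (le_add_of_nonneg_right (G.step_pos n).le).trans_eq (G.time_succ n).symm

lemma step_le_tau (n : ℕ) : G.step n ≤ G.tau := le_ciSup G.bdd n

lemma tau_pos : 0 < G.tau := (G.step_pos 0).trans_le (G.step_le_tau 0)

-- The recursion is only available as long as `E n ≤ B`; the resulting bound keeps `E` below `B`.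
lemma le_of_step_le_of_le {E : ℕ → ℝ} {A B L c T : ℝ} (hA : 0 ≤ A) (hL : 0 ≤ L) (hc : 0 ≤ c)
    (h0 : E 0 ≤ A)
    (hstep : ∀ n, G.time (n + 1) ≤ T → E n ≤ B →
      E (n + 1) ≤ (1 + L * G.step n) * E n + G.step n * c)
    (hB : Real.exp (L * T) * (A + T * c) ≤ B) {n : ℕ} (hn : G.time n ≤ T) :
    E n ≤ Real.exp (L * T) * (A + T * c) := by
  have mono {t : ℝ} (ht : 0 ≤ t) (htT : t ≤ T) :
      Real.exp (L * t) * (A + t * c) ≤ Real.exp (L * T) * (A + T * c) := by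
    gcongr
  suffices key : E n ≤ Real.exp (L * G.time n) * (A + G.time n * c) from
    key.trans (mono (G.time_nonneg n) hn)
  induction n with
  | zero => simpa only [G.time_zero, mul_zero, Real.exp_zero, zero_mul, add_zero, one_mul] using h0
  | succ n ih =>
    have hs := G.step_pos n
    have htn := G.time_nonneg n
    have htT := (G.time_le_time_succ n).trans hn
    have hexp : 1 + L * G.step n ≤ Real.exp (L * G.step n) := by
      rw [add_comm]; exact Real.add_one_le_exp _
    have hone : 1 ≤ Real.exp (L * (G.time n + G.step n)) := Real.one_le_exp (by positivity)
    calc E (n + 1) ≤ (1 + L * G.step n) * E n + G.step n * c :=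
          hstep n hn ((ih htT).trans ((mono htn htT).trans hB))
      _ ≤ Real.exp (L * G.step n) * (Real.exp (L * G.time n) * (A + G.time n * c)) +
            Real.exp (L * (G.time n + G.step n)) * (G.step n * c) := by
          refine add_le_add ?_ (le_mul_of_one_le_left (by positivity) hone)
          exact (mul_le_mul_of_nonneg_left (ih htT) (by positivity)).trans (by gcongr)
      _ = Real.exp (L * G.time (n + 1)) * (A + G.time (n + 1) * c) := by
          rw [G.time_succ, mul_add L, Real.exp_add]; ring

end TimeGrid

section ExplicitStep

variable {N : ℕ} {M : Mesh} {i : ℕ}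

lemma fluxDiff_sub (W V : ℕ → ℝ) :
    fluxDiff N M (fun j => W j - V j) i = fluxDiff N M W i - fluxDiff N M V i := by
  simp only [fluxDiff]
  ring

-- Under the step restriction the explicit step has nonnegative coefficients summing to the mass.
lemma abs_mass_mul_add_fluxDiff_le {G : TimeGrid} {θ : ℕ → ℝ} {a s : ℝ} (hi : i < M.m)
    (hG : StepRestriction N M G) (hs : 0 ≤ s) (hsτ : s ≤ G.tau) (hθ : ∀ j ≤ M.m, |θ j| ≤ a) :
    |mass N M i * θ i + s * fluxDiff N M θ i| ≤ mass N M i * a := by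
  have hl := stiffness_left_nonneg (N := N) hi
  have hr := (stiffness_right_pos (N := N) hi).le
  have hτ := (mul_le_mul_of_nonneg_right hsτ (add_nonneg hl hr)).trans
    (tau_mul_stiffness_le_mass hi hG)
  rw [fluxDiff]
  generalize stiffness N (M.x (i - 1)) (M.x i) = l at *
  generalize stiffness N (M.x i) (M.x (i + 1)) = r at *
  have hdiag : 0 ≤ mass N M i - s * (l + r) := sub_nonneg.2 hτ
  calc |mass N M i * θ i + s * (r * (θ (i + 1) - θ i) - l * (θ i - θ (i - 1)))|
      = |(mass N M i - s * (l + r)) * θ i + s * r * θ (i + 1) + s * l * θ (i - 1)| := by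
        congr 1; ring
    _ ≤ (mass N M i - s * (l + r)) * |θ i| + s * r * |θ (i + 1)| + s * l * |θ (i - 1)| := by
        refine (abs_add_three _ _ _).trans_eq ?_
        rw [abs_mul, abs_mul (s * r), abs_mul (s * l), abs_of_nonneg hdiag,
          abs_of_nonneg (mul_nonneg hs hr), abs_of_nonneg (mul_nonneg hs hl)]
    _ ≤ (mass N M i - s * (l + r)) * a + s * r * a + s * l * a := by
        gcongr
        exacts [hθ i hi.le, hθ (i + 1) hi, hθ (i - 1) (by omega)]
    _ = mass N M i * a := by ring

lemma IsML2Solution.error_equation {f : ℝ → ℝ} {G : TimeGrid} {uh : ℕ → ℝ → ℝ} (hi : i < M.m)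
    (hsol : IsML2Solution N f M G uh) (n : ℕ) (P P' : ℕ → ℝ) (w : ℝ) :
    mass N M i * (uh (n + 1) (M.x i) - P' i) =
      mass N M i * (uh n (M.x i) - P i) +
          G.step n * fluxDiff N M (fun j => uh n (M.x j) - P j) i +
        mass N M i * G.step n * (f (uh n (M.x i)) - f w) -
        (mass N M i * (P' i - P i) - G.step n * (fluxDiff N M P i + mass N M i * f w)) := by
  rw [fluxDiff_sub]
  linear_combination hsol.nodal hi n

end ExplicitStep

section Solution

variable {N : ℕ} {f : ℝ → ℝ} {T : ℝ} {u₀ : ℝ → ℝ} {u : ℝ → ℝ → ℝ} {K : ℝ≥0} {M : Mesh}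
  {i : ℕ} {s t : ℝ}

namespace IsSolution

variable (hu : IsSolution N f T u₀ u) (hs : IsSmooth T u) (hκ : kappa T u ≤ K) (hT : 0 < T)
include hu hs hκ hT

lemma abs_ritz_sub_le (ht : t ∈ Icc 0 T) (hi : i ≤ M.m) :
    |ritz N M (fun y => partialX 1 u y t) i - u (M.x i) t| ≤ K * M.h :=
  RadialFEM.abs_ritz_sub_le (fun _ hx => hs.hasDerivWithinAt_space hx ht)
    (hs.lipschitzOnWith_partialX hκ one_lt_two ht) (hu.boundary_one_Icc hs hT ht) hi

lemma abs_ritz_increment_sub_le (hs' : s ∈ Icc 0 T) (ht : t ∈ Icc 0 T) (hi : i ≤ M.m) :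
    |(ritz N M (fun y => partialX 1 u y t) i - ritz N M (fun y => partialX 1 u y s) i) -
      (u (M.x i) t - u (M.x i) s)| ≤ K * |t - s| * M.h := by
  rw [← ritz_sub (hs.lipschitzOnWith_partialX hκ one_lt_two ht).continuousOn
    (hs.lipschitzOnWith_partialX hκ one_lt_two hs').continuousOn]
  refine RadialFEM.abs_ritz_sub_le (v := fun y => u y t - u y s)
    (fun x hx => (hs.hasDerivWithinAt_space hx ht).sub (hs.hasDerivWithinAt_space hx hs'))
    (hs.lipschitzOnWith_partialX_sub hκ one_lt_two ht hs') ?_ hi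
  rw [hu.boundary_one_Icc hs hT ht, hu.boundary_one_Icc hs hT hs', sub_zero]

variable (hN : 1 ≤ N) (hf : Continuous f)
include hN hf

lemma abs_mass_mul_sub_fluxDiff_ritz_le {L : ℝ≥0} (hL : LipschitzOnWith L f (Icc (-K) K))
    (hi : i < M.m) (ht : t ∈ Icc 0 T) :
    |mass N M i * (partialT T 1 u (M.x i) t - f (u (M.x i) t)) -
      fluxDiff N M (ritz N M fun y => partialX 1 u y t) i| ≤
      mass N M i * ((K + L * K) * M.h) := by
  have hbound : MapsTo (fun x => u x t) (Icc 0 1) (Icc (-K : ℝ) K) := fun x hx => by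
    have := abs_partialX_le (k := 0) hκ (by decide) hx ht
    rw [partialX_zero] at this
    exact abs_le.1 this
  have hg : LipschitzOnWith (K + L * K) (fun x => partialT T 1 u x t - f (u x t)) (Icc 0 1) :=
    (hs.lipschitzOnWith_partialT hκ hT ht).sub (hL.comp (hs.lipschitzOnWith_space hκ ht) hbound)
  rw [fluxDiff_ritz hN hi (hs.lipschitzOnWith_partialX hκ one_lt_two ht).continuousOn
    (hu.boundary_zero_Icc hs hT ht) hg.continuousOn
    (fun x hx => hu.hasDerivAt_partialX_one hs hT hf hx ht), abs_sub_comm]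
  exact abs_wInner_hat_sub_le hi hg

lemma abs_truncation_le {L : ℝ≥0} (hL : LipschitzOnWith L f (Icc (-K) K)) (hi : i < M.m)
    (hs' : 0 ≤ s) (hst : s ≤ t) (ht : t ≤ T) :
    |mass N M i * (ritz N M (fun y => partialX 1 u y t) i -
        ritz N M (fun y => partialX 1 u y s) i) -
      (t - s) * (fluxDiff N M (ritz N M fun y => partialX 1 u y s) i +
        mass N M i * f (u (M.x i) s))| ≤
      mass N M i * ((t - s) * ((2 * K + L * K) * (M.h + (t - s)))) := by
  have hmemS : s ∈ Icc 0 T := ⟨hs', hst.trans ht⟩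
  have hmass := (mass_pos (N := N) hi).le
  have hd : 0 ≤ t - s := sub_nonneg.2 hst
  have hincr := hu.abs_ritz_increment_sub_le hs hκ hT hmemS ⟨hs'.trans hst, ht⟩ hi.le
  rw [abs_of_nonneg hd] at hincr
  have htaylor := hs.abs_taylor_time_le hκ hT (M.x_mem hi.le) hs' hst ht
  have hspace := hu.abs_mass_mul_sub_fluxDiff_ritz_le hs hκ hT hN hf hL hi hmemS
  generalize ritz N M (fun y => partialX 1 u y t) i = Pt at *
  generalize ritz N M (fun y => partialX 1 u y s) = Ps at *
  calc |mass N M i * (Pt - Ps i) -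
        (t - s) * (fluxDiff N M Ps i + mass N M i * f (u (M.x i) s))|
      = |mass N M i * (Pt - Ps i - (u (M.x i) t - u (M.x i) s)) +
          mass N M i * (u (M.x i) t - u (M.x i) s - (t - s) * partialT T 1 u (M.x i) s) +
          (t - s) * (mass N M i * (partialT T 1 u (M.x i) s - f (u (M.x i) s)) -
            fluxDiff N M Ps i)| := by congr 1; ring
    _ ≤ mass N M i * (K * (t - s) * M.h) + mass N M i * (K * (t - s) ^ 2) +
          (t - s) * (mass N M i * ((K + L * K) * M.h)) := by
        refine (abs_add_three _ _ _).trans ?_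
        rw [abs_mul (mass N M i), abs_mul (mass N M i), abs_mul (t - s), abs_of_nonneg hmass,
          abs_of_nonneg hd]
        gcongr
    _ = mass N M i * ((t - s) * ((2 * K + L * K) * M.h + K * (t - s))) := by ring
    _ ≤ mass N M i * ((t - s) * ((2 * K + L * K) * (M.h + (t - s)))) := by
        rw [mul_add (2 * K + L * K : ℝ)]
        gcongr
        nlinarith [K.coe_nonneg, mul_nonneg L.coe_nonneg K.coe_nonneg]

end IsSolution

end Solution

/-- The difference `θⁿ` of the discrete solution and the Ritz projection of `u(·, t_n)`, as the
vector of its values at the nodes `x_0, …, x_m`. -/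
noncomputable def ritzError (N : ℕ) (M : Mesh) (G : TimeGrid) (u : ℝ → ℝ → ℝ) (uh : ℕ → ℝ → ℝ)
    (n : ℕ) (i : Fin (M.m + 1)) : ℝ :=
  uh n (M.x i) - ritz N M (fun y => partialX 1 u y (G.time n)) i

section Error

variable {N : ℕ} {f : ℝ → ℝ} {T : ℝ} {u₀ : ℝ → ℝ} {u : ℝ → ℝ → ℝ} {K L : ℝ≥0} {M : Mesh}
  {G : TimeGrid} {uh : ℕ → ℝ → ℝ} {n i : ℕ}

lemma abs_sub_ritz_le_norm_ritzError (hi : i ≤ M.m) :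
    |uh n (M.x i) - ritz N M (fun y => partialX 1 u y (G.time n)) i| ≤
      ‖ritzError N M G u uh n‖ :=
  norm_le_pi_norm (ritzError N M G u uh n) ⟨i, Nat.lt_succ_of_le hi⟩

lemma norm_ritzError_le {c : ℝ} (hc : 0 ≤ c)
    (h : ∀ i ≤ M.m, |uh n (M.x i) - ritz N M (fun y => partialX 1 u y (G.time n)) i| ≤ c) :
    ‖ritzError N M G u uh n‖ ≤ c :=
  (pi_norm_le_iff_of_nonneg hc).2 fun i => h i (Nat.le_of_lt_succ i.2)

variable (hu : IsSolution N f T u₀ u) (hs : IsSmooth T u) (hκ : kappa T u ≤ K) (hT : 0 < T)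
include hu hs hκ hT

namespace IsSolution

lemma abs_nodal_sub_le (hn : G.time n ≤ T) (hi : i ≤ M.m) :
    |uh n (M.x i) - u (M.x i) (G.time n)| ≤ ‖ritzError N M G u uh n‖ + K * M.h := by
  have hritz := hu.abs_ritz_sub_le hs hκ hT ⟨G.time_nonneg n, hn⟩ hi
  exact (abs_sub_le _ _ _).trans (add_le_add (abs_sub_ritz_le_norm_ritzError hi) hritz)

lemma norm_ritzError_zero_le {c : ℝ} (hc : ∀ y ∈ Icc (0 : ℝ) 1, |uh 0 y - u y 0| ≤ c) :
    ‖ritzError N M G u uh 0‖ ≤ c + K * M.h := by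
  have h0 : (0 : ℝ) ∈ Icc 0 T := ⟨le_rfl, hT.le⟩
  have hbound (i : ℕ) (hi : i ≤ M.m) :
      |uh 0 (M.x i) - ritz N M (fun y => partialX 1 u y (G.time 0)) i| ≤ c + K * M.h := by
    rw [G.time_zero]
    refine (abs_sub_le _ (u (M.x i) 0) _).trans (add_le_add (hc _ (M.x_mem hi)) ?_)
    rw [abs_sub_comm]
    exact hu.abs_ritz_sub_le hs hκ hT h0 hi
  exact norm_ritzError_le ((abs_nonneg _).trans (hbound 0 (Nat.zero_le _))) hbound

lemma abs_reaction_sub_le (hL : LipschitzOnWith L f (Icc (-(K + 1)) (K + 1)))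
    (hn : G.time n ≤ T) (hsmall : ‖ritzError N M G u uh n‖ + K * M.h ≤ 1) (hi : i ≤ M.m) :
    |f (uh n (M.x i)) - f (u (M.x i) (G.time n))| ≤
      L * (‖ritzError N M G u uh n‖ + K * M.h) := by
  have herr := hu.abs_nodal_sub_le (uh := uh) hs hκ hT hn hi
  have hbound : |u (M.x i) (G.time n)| ≤ K := by
    have := abs_partialX_le (k := 0) hκ (by decide) (M.x_mem hi) ⟨G.time_nonneg n, hn⟩
    rwa [partialX_zero] at this
  have hboundh : |uh n (M.x i)| ≤ K + 1 := by
    linarith [abs_sub_abs_le_abs_sub (uh n (M.x i)) (u (M.x i) (G.time n))]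
  exact (hL.dist_le_mul _ (abs_le.1 hboundh) _ (abs_le.1 (hbound.trans (by linarith)))).trans
    (mul_le_mul_of_nonneg_left herr L.coe_nonneg)

end IsSolution

variable (hN : 1 ≤ N) (hf : Continuous f) (hL : LipschitzOnWith L f (Icc (-(K + 1)) (K + 1)))
  (hG : StepRestriction N M G) (hsol : IsML2Solution N f M G uh)
include hN hf hL hG hsol

namespace IsML2Solution

lemma norm_ritzError_succ_le (hn : G.time (n + 1) ≤ T)
    (hsmall : ‖ritzError N M G u uh n‖ + K * M.h ≤ 1) :
    ‖ritzError N M G u uh (n + 1)‖ ≤ (1 + L * G.step n) * ‖ritzError N M G u uh n‖ +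
      G.step n * (2 * K * (1 + L) * (M.h + G.tau)) := by
  have hstep := G.step_pos n
  have hτ := G.tau_pos
  have hh := M.h_pos
  refine norm_ritzError_le (by positivity) fun i hi => ?_
  rcases hi.eq_or_lt with rfl | hi'
  · rw [Mesh.apply_last_of_mem_space (hsol.mem _), ritz_last, sub_zero, abs_zero]
    positivity
  have hn' := (G.time_le_time_succ n).trans hn
  have hmass := mass_pos (N := N) hi'
  have htrunc := hu.abs_truncation_le hs hκ hT hN hf
    (hL.mono (Icc_subset_Icc (by linarith) (by linarith))) hi' (G.time_nonneg n)
    (G.time_le_time_succ n) hn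
  rw [G.time_succ, add_sub_cancel_left, ← G.time_succ] at htrunc
  have hreact := hu.abs_reaction_sub_le hs hκ hT hL hn' hsmall hi
  have hmax := abs_mass_mul_add_fluxDiff_le hi' hG hstep.le (G.step_le_tau n)
    fun j hj => abs_sub_ritz_le_norm_ritzError (N := N) (G := G) (u := u) (uh := uh) (n := n) hj
  have herror := hsol.error_equation hi' n (ritz N M fun y => partialX 1 u y (G.time n))
    (ritz N M fun y => partialX 1 u y (G.time (n + 1))) (u (M.x i) (G.time n))
  refine le_of_mul_le_mul_left ?_ hmass
  rw [← abs_of_pos hmass, ← abs_mul, herror, abs_of_pos hmass]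
  generalize ‖ritzError N M G u uh n‖ = a at *
  refine (abs_sub _ _).trans ((add_le_add_left (abs_add_le _ _) _).trans ?_)
  rw [abs_mul _ (f _ - f _), abs_of_pos (mul_pos hmass hstep)]
  calc _ ≤ mass N M i * a + mass N M i * G.step n * (L * (a + K * M.h)) +
          mass N M i * (G.step n * ((2 * K + L * K) * (M.h + G.step n))) := by gcongr
    _ ≤ mass N M i * a + mass N M i * G.step n * (L * (a + K * (M.h + G.tau))) +
          mass N M i * (G.step n * ((2 * K + L * K) * (M.h + G.tau))) := by
        gcongr
        exacts [le_add_of_nonneg_right hτ.le, G.step_le_tau n]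
    _ = mass N M i * ((1 + L * G.step n) * a +
          G.step n * (2 * K * (1 + L) * (M.h + G.tau))) := by ring

end IsML2Solution

end Error

section Convergence

variable {N : ℕ} {f : ℝ → ℝ} {T C₀ : ℝ} {u₀ : ℝ → ℝ} {u : ℝ → ℝ → ℝ} {K L : ℝ≥0} {M : Mesh}
  {G : TimeGrid} {uh : ℕ → ℝ → ℝ} {n : ℕ}

/-- The factor of `h + τ` in the bound for the nodal error `θⁿ`, in which
`C₀ + K` bounds the initial error and `2K(1 + L)` the truncation error per unit of time. -/
noncomputable def ritzErrorConst (T C₀ : ℝ) (K L : ℝ≥0) : ℝ :=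
  Real.exp (L * T) * (C₀ + K + T * (2 * K * (1 + L)))

lemma ritzErrorConst_pos (hT : 0 < T) (hC₀ : 0 < C₀) : 0 < ritzErrorConst T C₀ K L := by
  unfold ritzErrorConst
  positivity

variable (hu : IsSolution N f T u₀ u) (hs : IsSmooth T u) (hκ : kappa T u ≤ K) (hT : 0 < T)
  (hN : 1 ≤ N) (hf : Continuous f) (hL : LipschitzOnWith L f (Icc (-(K + 1)) (K + 1)))
  (hG : StepRestriction N M G) (hsol : IsML2Solution N f M G uh) (hC₀ : 0 ≤ C₀)
  (hsmall : ritzErrorConst T C₀ K L * (M.h + G.tau) + K * M.h ≤ 1)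
  (hinit : ∀ y ∈ Icc (0 : ℝ) 1, |uh 0 y - u y 0| ≤ C₀ * M.h) (hn : G.time n ≤ T)
include hu hs hκ hT hN hf hL hG hsol hC₀ hsmall hinit hn

namespace IsML2Solution

lemma norm_ritzError_le :
    ‖ritzError N M G u uh n‖ ≤ ritzErrorConst T C₀ K L * (M.h + G.tau) := by
  have hh := M.h_pos
  have hτ := G.tau_pos
  have hconst : Real.exp (L * T) * ((C₀ + K) * (M.h + G.tau) +
      T * (2 * K * (1 + L) * (M.h + G.tau))) = ritzErrorConst T C₀ K L * (M.h + G.tau) := by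
    rw [ritzErrorConst]; ring
  have hzero : ‖ritzError N M G u uh 0‖ ≤ (C₀ + K) * (M.h + G.tau) :=
    (hu.norm_ritzError_zero_le hs hκ hT hinit).trans (by
      rw [← add_mul]; gcongr; exact le_add_of_nonneg_right hτ.le)
  rw [← hconst]
  exact G.le_of_step_le_of_le (B := 1 - K * M.h) (by positivity) L.coe_nonneg (by positivity)
    hzero (fun n hn hle => hsol.norm_ritzError_succ_le hu hs hκ hT hN hf hL hG hn
      (le_sub_iff_add_le.1 hle)) (hconst.trans_le (le_sub_iff_add_le.2 hsmall)) hn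

lemma abs_sub_le {y : ℝ} (hy : y ∈ Icc 0 1) :
    |uh n y - u y (G.time n)| ≤ (ritzErrorConst T C₀ K L + 2 * K) * (M.h + G.tau) := by
  have hθ := hsol.norm_ritzError_le hu hs hκ hT hN hf hL hG hC₀ hsmall hinit hn
  have hnodal (i : ℕ) (hi : i ≤ M.m) : |uh n (M.x i) - u (M.x i) (G.time n)| ≤
      ritzErrorConst T C₀ K L * (M.h + G.tau) + K * M.h :=
    (hu.abs_nodal_sub_le hs hκ hT hn hi).trans (by gcongr)
  refine (M.abs_sub_le_of_nodal (hsol.mem n)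
    (hs.lipschitzOnWith_space hκ ⟨G.time_nonneg n, hn⟩) hnodal hy).trans ?_
  have : 0 ≤ K * G.tau := mul_nonneg K.coe_nonneg G.tau_pos.le
  linarith

end IsML2Solution

end Convergence

lemma exists_threshold (K : ℝ≥0) {C : ℝ} (hC : 0 < C) :
    ∃ ε > 0, ε ≤ 1 ∧ ∀ h ≤ ε, ∀ τ ≤ ε, C * (h + τ) + K * h ≤ 1 := by
  have hpos : 0 < 2 * C + K := by positivity
  refine ⟨min 1 (1 / (2 * C + K)), by positivity, min_le_left _ _, fun h hh τ hτ => ?_⟩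
  set ε := min 1 (1 / (2 * C + K))
  calc C * (h + τ) + K * h ≤ C * (ε + ε) + K * ε := by gcongr
    _ = ε * (2 * C + K) := by ring
    _ ≤ 1 := (le_div_iff₀ hpos).1 (min_le_right _ _)

end RadialFEM

theorem theorem2p6_general (N : ℕ) (hN : 1 ≤ N) (f : ℝ → ℝ) (hf : LocallyLipschitz f)
    (T : ℝ) (hT : 0 < T) (K : ℝ≥0) (C₀ : ℝ) (hC₀ : 0 < C₀) :
    ∃ C > (0 : ℝ), ∃ h₀ > (0 : ℝ), ∃ τ₀ > (0 : ℝ),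
      ∀ (u₀ : ℝ → ℝ) (u : ℝ → ℝ → ℝ),
        ContinuousOn u₀ (Set.Icc 0 1) →
        RadialFEM.IsSmooth T u →
        RadialFEM.IsSolution N f T u₀ u →
        RadialFEM.kappa T u ≤ K →
      ∀ (M : RadialFEM.Mesh) (G : RadialFEM.TimeGrid) (uh : ℕ → ℝ → ℝ),
        M.h ≤ h₀ →
        G.tau ≤ τ₀ →
        RadialFEM.StepRestriction N M G →
        RadialFEM.IsML2Solution N f M G uh →
        RadialFEM.supNorm (Set.Icc 0 1) (fun x => uh 0 x - u₀ x)
          ≤ ENNReal.ofReal (C₀ * M.h ^ 2) →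
        (⨆ n, ⨆ (_ : G.time n ≤ T),
          RadialFEM.supNorm (Set.Icc 0 1) (fun x => uh n x - u x (G.time n)))
          ≤ ENNReal.ofReal (C * (M.h + G.tau)) := by
  obtain ⟨L, hL⟩ := (hf.locallyLipschitzOn
    (s := Set.Icc (-(K + 1 : ℝ)) (K + 1))).exists_lipschitzOnWith_of_compact isCompact_Icc
  have hC := RadialFEM.ritzErrorConst_pos (K := K) (L := L) hT hC₀
  obtain ⟨ε, hε, hε1, hsmall⟩ := RadialFEM.exists_threshold K hC
  refine ⟨RadialFEM.ritzErrorConst T C₀ K L + 2 * K, by positivity, ε, hε, ε, hε, ?_⟩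
  intro u₀ u hu₀ hs hu hκ M G uh hh hτ hG hsol hinit
  have hhpos := M.h_pos
  have hτpos := G.tau_pos
  have hinit' : ∀ y ∈ Set.Icc (0 : ℝ) 1, |uh 0 y - u y 0| ≤ C₀ * M.h := fun y hy => by
    rw [show u y 0 = u₀ y from hu.initial_Icc hs hT hu₀ hy]
    refine ((RadialFEM.supNorm_le_ofReal (by positivity)).1 hinit y hy).trans ?_
    gcongr
    exact pow_le_of_le_one hhpos.le (hh.trans hε1) two_ne_zero
  refine iSup₂_le fun n hn => (RadialFEM.supNorm_le_ofReal (by positivity)).2 fun y hy => ?_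
  exact hsol.abs_sub_le hu hs hκ hT hN hf.continuous hL hG hC₀.le (hsmall _ hh _ hτ) hinit' hn hy

theorem theorem2p6 (N : ℕ) (hN : 2 ≤ N) (f : ℝ → ℝ) (hf : LocallyLipschitz f)
    (T : ℝ) (hT : 0 < T) (K : ℝ≥0) (C₀ : ℝ) (hC₀ : 0 < C₀) (β : ℝ) (hβ : 0 < β) :
    ∃ C > (0 : ℝ), ∃ h₀ > (0 : ℝ), ∃ τ₀ > (0 : ℝ),
      ∀ (u₀ : ℝ → ℝ) (u : ℝ → ℝ → ℝ),
        ContinuousOn u₀ (Set.Icc 0 1) →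
        RadialFEM.IsSmooth T u →
        RadialFEM.IsSolution N f T u₀ u →
        RadialFEM.kappa T u ≤ K →
      ∀ (M : RadialFEM.Mesh) (G : RadialFEM.TimeGrid) (uh : ℕ → ℝ → ℝ),
        M.QuasiUniform β →
        M.h ≤ h₀ →
        G.tau ≤ τ₀ →
        RadialFEM.StepRestriction N M G →
        RadialFEM.IsML2Solution N f M G uh →
        RadialFEM.supNorm (Set.Icc 0 1) (fun x => uh 0 x - u₀ x)
          ≤ ENNReal.ofReal (C₀ * M.h ^ 2) →
        (⨆ n, ⨆ (_ : G.time n ≤ T),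
          RadialFEM.supNorm (Set.Icc 0 1) (fun x => uh n x - u x (G.time n)))
          ≤ ENNReal.ofReal (C * (M.h + G.tau)) := by
  obtain ⟨C, hC, h₀, hh₀, τ₀, hτ₀, hbound⟩ :=
    theorem2p6_general N (one_le_two.trans hN) f hf T hT K C₀ hC₀
  exact ⟨C, hC, h₀, hh₀, τ₀, hτ₀, fun u₀ u hu₀ hs hu hκ M G uh _ =>
    hbound u₀ u hu₀ hs hu hκ M G uh⟩
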